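/- Let $P=(X,\prec)$ be a finite poset with $n=|X|$ elements. A linear extension of $P$ is a bijection $f:X\to\{1,\dots,n\}$ such that $f(x)<f(y)$ whenever $x\prec y$; let $\mathbf{P}$ denote probability with respect to a uniformly random linear extension $f$ of $P$. For $S\subseteq X$ write $f(S)=\{f(x):x\in S\}$ and $S{\uparrow}=\{x\in X:\ x\succcurlyeq s\text{ for some }s\in S\}$. Let $A,B,C\subseteq X$ be pairwise disjoint nonempty sets of minimal elements of $P$. Then $$\frac{\mathbf{P}\big[1\in f(C),\,2\in f(C{\uparrow})\big]\cdot\mathbf{P}\big[1\in f(A),\,2\in f(B)\big]}{\mathbf{P}\big[1\in f(A),\,2\in f(C)\big]\cdot\mathbf{P}\big[1\in f(B),\,2\in f(C)\big]}\ \le\ 2 .$$ Moreover, there exists a permutation $(A',B',C')$ of $(A,B,C)$ such that $$\frac{\mathbf{P}\big[1\in f(C'),\,2\in f(C'{\uparrow})\big]\cdot\mathbf{P}\big[1\in f(A'),\,2\in f(B')\big]}{\mathbf{P}\big[1\in f(A'),\,2\in f(C')\big]\cdot\mathbf{P}\big[1\in f(B'),\,2\in f(C')\big]}\ \le\ 1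 .$$ (The denominators are positive.) -/

import Mathlib

/-- The set of linear extensions of a finite poset `X` with `n` elements: bijections
`f : X → {1, …, n}` such that `f x < f y` whenever `x < y`. -/
abbrev PosetLinExt (X : Type*) [PartialOrder X] [Fintype X] : Type _ :=
  {f : X ≃ Finset.Icc 1 (Fintype.card X) // ∀ x y : X, x < y → f x < f y}

namespace PosetLinExt

/-- `f(A) = {f(x) : x ∈ A}`, as a set of natural numbers. -/
def image {X : Type*} [PartialOrder X] [Fintype X] (f : PosetLinExt X) (A : Set X) : Set ℕ :=
  (fun x : X => (f.1 x : ℕ)) '' A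

/-- The probability of an event for a uniformly random linear extension:
the number of linear extensions in the event over the number of all linear extensions. -/
noncomputable def prob {X : Type*} [PartialOrder X] [Fintype X] (E : Set (PosetLinExt X)) : ℝ :=
  (E.ncard : ℝ) / (Nat.card (PosetLinExt X) : ℝ)

/-- `P[1 ∈ f(S), 2 ∈ f(T)]` for a uniformly random linear extension `f`. -/
noncomputable def probOneTwo {X : Type*} [PartialOrder X] [Fintype X] (S T : Set X) : ℝ :=
  prob {f : PosetLinExt X | 1 ∈ f.image S ∧ 2 ∈ f.image T}

end PosetLinExt

open Finset

/-! Count linear extensions by their first two elements. On functions on the minimal elements this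
gives a symmetric form `B` (`extForm`): the entry at `x ≠ y` counts the extensions that start with
`x, y`, and the diagonal entry at `x` counts those that start with `x` followed by an element that
was not minimal before. For disjoint sets of minimal elements `B 1_A 1_B` counts the event `1 ∈
f(A), 2 ∈ f(B)`, and `B 1_C 1_C` counts `1 ∈ f(C), 2 ∈ f(C↑)`.

The heart is that `B` is hyperbolic: `B v v * B 1 1 ≤ (B 1 v)²` (`extForm_self_mul_le_sq`), by
induction on the size of the poset. The row sum at `x` is the number of extensions of `S.erase x`.
Comparison with the forms one level down (`extForm_le_sum_transfer`) and the induction hypothesis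
give `⟪v, T v⟫ ≤ ‖T v‖²` for the normalised matrix `T`. Its eigenvalues therefore avoid the open
interval `(0, 1)`; they are at most `1`, and `1` belongs to the constants alone, so the form is
nonpositive on the complement of the constants.

Hyperbolicity passes from `1` to any `c` with `B c c ≥ 0`. Taking `c = 1_C` and combinations of
`1_A, 1_B` gives the bound `2`. For the bound `1`, the ratios with `C` and with `A` in the special
role have product `B 1_A 1_A * B 1_C 1_C / (B 1_A 1_C)² ≤ 1`, so one of them is at most `1`. -/

/-! ### Linear algebra of hyperbolic forms. -/

/-- A symmetric matrix with positive off-diagonal entries and positive row sums whose normalisation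
`T` satisfies `⟪v, T v⟫ ≤ ‖T v‖²` is negative semidefinite on the complement of the constants. -/
theorem sum_mul_mulVec_nonpos_of_le_sum_sq_div {ι : Type*} [Fintype ι]
    (N : Matrix ι ι ℝ) (hN : ∀ i j, N i j = N j i) (hpos : ∀ i j, i ≠ j → 0 < N i j)
    (d : ι → ℝ) (hd : ∀ i, d i = ∑ j, N i j) (hd0 : ∀ i, 0 < d i)
    (h : ∀ v : ι → ℝ, ∑ i, v i * ∑ j, N i j * v j ≤ ∑ i, (∑ j, N i j * v j) ^ 2 / d i)
    (v : ι → ℝ) (hv : ∑ i, d i * v i = 0) : ∑ i, v i * ∑ j, N i j * v j ≤ 0 := by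
  classical
  set s : ι → ℝ := fun i => √(d i) with hs
  have hs0 : ∀ i, 0 < s i := fun i => Real.sqrt_pos.2 (hd0 i)
  have hsd : ∀ i, s i * s i = d i := fun i => Real.mul_self_sqrt (hd0 i).le
  set M : Matrix ι ι ℝ := fun i j => N i j / (s i * s j) with hM
  have hMh : M.IsHermitian := by
    ext i j
    rw [Matrix.conjTranspose_apply, star_trivial]
    simp only [hM]
    rw [hN, mul_comm]
  -- eigenvectors of `M` come from generalised eigenvectors of `N`
  have key : ∀ k, 0 < hMh.eigenvalues k →
      ∑ i, (hMh.eigenvectorBasis k).ofLp i * (s i * v i) = 0 := by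
    intro k hk
    set l := hMh.eigenvalues k with hl
    set u : ι → ℝ := (hMh.eigenvectorBasis k).ofLp with hu
    have hMu : ∀ i, ∑ j, M i j * u j = l * u i := by
      intro i
      have := congrFun (hMh.mulVec_eigenvectorBasis k) i
      simpa [Matrix.mulVec, dotProduct] using this
    set w : ι → ℝ := fun i => u i / s i with hw
    have huw : ∀ i, u i = s i * w i := fun i => by
      simp only [hw]; field_simp [(hs0 i).ne']
    have hNw : ∀ i, ∑ j, N i j * w j = l * d i * w i := by
      intro i
      have h1 : ∑ j, N i j * w j = s i * ∑ j, M i j * u j := by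
        rw [mul_sum]
        refine sum_congr rfl fun j _ => ?_
        have := (hs0 i).ne'
        have := (hs0 j).ne'
        simp only [hM, hw]
        field_simp
      rw [h1, hMu, huw, ← hsd]; ring
    have hE0 : 0 ≤ ∑ i, d i * w i ^ 2 :=
      sum_nonneg fun i _ => mul_nonneg (hd0 i).le (sq_nonneg _)
    have h1 : l * ∑ i, d i * w i ^ 2 ≤ l ^ 2 * ∑ i, d i * w i ^ 2 := by
      have := h w
      simp only [hNw] at this
      convert this using 1
      · rw [mul_sum]; exact sum_congr rfl fun i _ => by ring
      · rw [mul_sum]; exact sum_congr rfl fun i _ => by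
          have := (hd0 i).ne'
          field_simp
    -- The Laplacian quadratic form of the weights `N`. Its sign gives `l ≤ 1`, whereas `h1` with `l
    -- > 0` gives `l ≥ 1`; hence it vanishes and `w` is constant.
    have h2 : ∑ i, ∑ j, N i j * (w i - w j) ^ 2 = 2 * ((1 - l) * ∑ i, d i * w i ^ 2) := by
      have e1 : ∑ i, ∑ j, N i j * (w i - w j) ^ 2 =
          ∑ i, ∑ j, N i j * w i ^ 2 + ∑ i, ∑ j, N i j * w j ^ 2
            - 2 * ∑ i, w i * ∑ j, N i j * w j := by
        simp only [mul_sum, ← sum_add_distrib, ← sum_sub_distrib]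
        exact sum_congr rfl fun i _ => sum_congr rfl fun j _ => by ring
      have e2 : ∑ i, ∑ j, N i j * w j ^ 2 = ∑ i, ∑ j, N i j * w i ^ 2 := by
        rw [sum_comm]
        exact sum_congr rfl fun i _ => sum_congr rfl fun j _ => by rw [hN]
      have e3 : ∑ i, ∑ j, N i j * w i ^ 2 = ∑ i, d i * w i ^ 2 :=
        sum_congr rfl fun i _ => by rw [hd, sum_mul]
      rw [e1, e2, e3]
      simp only [hNw]
      have e4 : ∑ i, w i * (l * d i * w i) = l * ∑ i, d i * w i ^ 2 := by
        rw [mul_sum]; exact sum_congr rfl fun i _ => by ring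
      rw [e4]; ring
    have h3 : ∀ i j, 0 ≤ N i j * (w i - w j) ^ 2 := by
      intro i j
      rcases eq_or_ne i j with rfl | hij
      · simp
      · exact mul_nonneg (hpos i j hij).le (sq_nonneg _)
    have h4 : ∑ i, ∑ j, N i j * (w i - w j) ^ 2 = 0 := by
      refine le_antisymm ?_ (sum_nonneg fun i _ => sum_nonneg fun j _ => h3 i j)
      rw [h2]
      nlinarith
    have h5 : ∀ i j, w i = w j := by
      intro i j
      rcases eq_or_ne i j with rfl | hij
      · rfl
      · have a := (sum_eq_zero_iff_of_nonneg fun i _ => sum_nonneg fun j _ => h3 i j).1 h4 i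
          (mem_univ _)
        have b := (sum_eq_zero_iff_of_nonneg fun j _ => h3 i j).1 a j (mem_univ _)
        have c := (mul_eq_zero.1 b).resolve_left (hpos i j hij).ne'
        exact sub_eq_zero.1 (pow_eq_zero_iff (two_ne_zero) |>.1 c)
    -- Eigenvalues are indexed by `ι` itself, so `k` also serves as a point at which to read off the
    -- constant value of `w`.
    have h6 : ∑ i, u i * (s i * v i) = w k * ∑ i, d i * v i := by
      rw [mul_sum]
      refine sum_congr rfl fun i _ => ?_
      rw [huw, ← hsd, h5 k i]; ring
    rw [h6, hv, mul_zero]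
  set x : EuclideanSpace ℝ ι := WithLp.toLp 2 fun i => s i * v i with hx
  have hform : ∑ i, v i * ∑ j, N i j * v j = ∑ i, (s i * v i) * ∑ j, M i j * (s j * v j) := by
    refine sum_congr rfl fun i _ => ?_
    rw [mul_sum, mul_sum]
    refine sum_congr rfl fun j _ => ?_
    have := (hs0 i).ne'
    have := (hs0 j).ne'
    simp only [hM]
    field_simp
  have hspec : ∑ i, (s i * v i) * ∑ j, M i j * (s j * v j) =
      ∑ k, hMh.eigenvalues k * (∑ i, (hMh.eigenvectorBasis k).ofLp i * (s i * v i)) ^ 2 := by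
    have hc : ∀ k, ∑ i, (hMh.eigenvectorBasis k).ofLp i * (s i * v i) =
        inner ℝ (hMh.eigenvectorBasis k) x := by
      intro k
      simp [PiLp.inner_apply, hx, mul_comm]
    have hMx : ∀ k, inner ℝ (hMh.eigenvectorBasis k)
        (WithLp.toLp 2 (M.mulVec x.ofLp) : EuclideanSpace ℝ ι) =
        hMh.eigenvalues k * inner ℝ (hMh.eigenvectorBasis k) x := by
      intro k
      have h1 : ∀ i, ∑ j, M i j * (hMh.eigenvectorBasis k).ofLp j
          = hMh.eigenvalues k * (hMh.eigenvectorBasis k).ofLp i := by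
        intro i
        have := congrFun (hMh.mulVec_eigenvectorBasis k) i
        simpa [Matrix.mulVec, dotProduct] using this
      have hMs : ∀ i j, M i j = M j i := fun i j => by
        simp only [hM]; rw [hN, mul_comm (s i)]
      simp only [PiLp.inner_apply, RCLike.inner_apply, conj_trivial, Matrix.mulVec, dotProduct]
      rw [mul_sum]
      simp only [sum_mul]
      rw [sum_comm]
      refine sum_congr rfl fun j _ => ?_
      have := h1 j
      calc _ = x.ofLp j * ∑ i, M j i * (hMh.eigenvectorBasis k).ofLp i := by
            rw [mul_sum]
            exact sum_congr rfl fun i _ => by rw [hMs]; ring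
        _ = _ := by rw [this]; ring
    have h0 : ∑ i, (s i * v i) * ∑ j, M i j * (s j * v j) =
        inner ℝ x (WithLp.toLp 2 (M.mulVec x.ofLp) : EuclideanSpace ℝ ι) := by
      simp [PiLp.inner_apply, hx, Matrix.mulVec, dotProduct, mul_comm]
    rw [h0, ← hMh.eigenvectorBasis.sum_inner_mul_inner]
    refine sum_congr rfl fun k _ => ?_
    rw [hMx, hc, real_inner_comm]; ring
  rw [hform, hspec]
  refine sum_nonpos fun k _ => ?_
  rcases le_or_gt (hMh.eigenvalues k) 0 with h0 | h0
  · exact mul_nonpos_of_nonpos_of_nonneg h0 (sq_nonneg _)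
  · rw [key k h0]; simp

/-- The reversed Cauchy–Schwarz inequality at one vector `e` with `0 < B e e` implies it at every
vector. -/
theorem LinearMap.mul_le_sq_of_reversed {V : Type*} [AddCommGroup V] [Module ℝ V]
    (B : V →ₗ[ℝ] V →ₗ[ℝ] ℝ) (hB : ∀ u v, B u v = B v u) (e : V)
    (h : ∀ v, B v v * B e e ≤ B e v ^ 2) (he : 0 < B e e)
    (v c : V) (hc : 0 ≤ B c c) : B v v * B c c ≤ B c v ^ 2 := by
  rcases hc.eq_or_lt with hc | hc
  · rw [← hc, mul_zero]; positivity
  by_contra! hlt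
  -- The part of `v` orthogonal to `c`. If the inequality fails, `B` is positive definite on the
  -- plane spanned by `u` and `c`.
  set u : V := B c c • v - B c v • c with hu
  have huc : B u c = 0 := by simp [hu, hB c v]; ring
  have huu : 0 < B u u := by
    have : B u u = B c c * (B v v * B c c - B c v ^ 2) := by
      simp [hu, hB v c]; ring
    rw [this]; exact mul_pos hc (by linarith)
  -- A vector of this plane orthogonal to `e`: the hypothesis at `w` forces `B w w ≤ 0`, while `B e
  -- c ≠ 0` makes `B w w` positive.
  set w : V := B e c • u - B e u • c with hw
  have hew : B e w = 0 := by simp [hw]; ring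
  have hww : B w w = B e c ^ 2 * B u u + B e u ^ 2 * B c c := by
    have : B c u = 0 := by rw [hB, huc]
    simp [hw, huc, this]; ring
  have h1 := h w
  rw [hew, hww] at h1
  have h2 := h c
  have h3 : 0 < B e c ^ 2 := lt_of_lt_of_le (mul_pos hc he) h2
  nlinarith [mul_pos (mul_pos h3 huu) he, mul_nonneg (mul_nonneg (sq_nonneg (B e u)) hc.le) he.le]

/-- In the reversed inequality at `s • a + t • b` the terms with `B a a` and `B b b` are nonnegative
and can be dropped; only the cross term remains. -/
theorem LinearMap.mul_le_two_mul_of_reversed {V : Type*} [AddCommGroup V] [Module ℝ V]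
    (B : V →ₗ[ℝ] V →ₗ[ℝ] ℝ) (hB : ∀ u v, B u v = B v u)
    (a b c : V) (h : ∀ v, B v v * B c c ≤ B c v ^ 2)
    (ha : 0 ≤ B a a) (hb : 0 ≤ B b b) (hc : 0 ≤ B c c) (hac : 0 < B a c) (hbc : 0 < B b c) :
    B c c * B a b ≤ 2 * (B a c * B b c) := by
  by_contra! hlt
  -- apply the hypothesis to `s • a - t • b`
  have key : ∀ s t : ℝ, 2 * s * t * (B c a * B c b - B c c * B a b) ≤
      s ^ 2 * B c a ^ 2 + t ^ 2 * B c b ^ 2 := by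
    intro s t
    have := h (s • a - t • b)
    simp [hB b a] at this
    nlinarith [mul_nonneg (sq_nonneg s) (mul_nonneg ha hc),
      mul_nonneg (sq_nonneg t) (mul_nonneg hb hc)]
  have key' : ∀ s t : ℝ, 2 * s * t * (B c c * B a b - B c a * B c b) ≤
      s ^ 2 * B c a ^ 2 + t ^ 2 * B c b ^ 2 := by
    intro s t
    have := key s (-t)
    nlinarith
  rw [hB a c, hB b c] at *
  -- These weights make both squares on the right equal to `(B c a * B c b) ^ 2`; this is the source
  -- of the constant `2`.
  have := key' (B c b) (B c a)
  nlinarith [mul_pos hac hbc]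

/-! ### The form of initial pairs and its recursion. -/

section Extensions

variable {X : Type*} [PartialOrder X]

open Classical in
/-- The minimal elements of the subposet `S`. -/
noncomputable def minElems (S : Finset X) : Finset X := S.filter fun x => ∀ y ∈ S, ¬ y < x

theorem mem_minElems {S : Finset X} {x : X} : x ∈ minElems S ↔ x ∈ S ∧ ∀ y ∈ S, ¬ y < x := by
  simp [minElems]

theorem minElems_subset (S : Finset X) : minElems S ⊆ S := fun _ hx => (mem_minElems.1 hx).1

theorem minElems_nonempty {S : Finset X} (hS : S.Nonempty) : (minElems S).Nonempty := by
  obtain ⟨x, hx⟩ := S.exists_minimal hS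
  exact ⟨x, mem_minElems.2 ⟨hx.1, fun y hy hlt => hlt.not_ge (hx.2 hy hlt.le)⟩⟩

variable [DecidableEq X]

/-- The number of linear extensions of the subposet `S`, by removal of the first element. -/
noncomputable def extCount (S : Finset X) : ℕ :=
  if S = ∅ then 1 else ∑ x ∈ (minElems S).attach, extCount (S.erase x)
termination_by S.card
decreasing_by exact card_erase_lt_of_mem (minElems_subset S x.2)

theorem extCount_empty : extCount (∅ : Finset X) = 1 := by rw [extCount]; simp

theorem extCount_eq_sum {S : Finset X} (hS : S.Nonempty) :
    extCount S = ∑ x ∈ minElems S, extCount (S.erase x) := by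
  rw [extCount, if_neg hS.ne_empty, sum_attach (minElems S) fun x => extCount (S.erase x)]

theorem extCount_pos (S : Finset X) : 0 < extCount S := by
  induction S using Finset.strongInduction with
  | H S ih =>
    rcases S.eq_empty_or_nonempty with rfl | hS
    · simp [extCount_empty]
    · rw [extCount_eq_sum hS]
      exact sum_pos (fun x hx => ih _ (erase_ssubset (minElems_subset S hx))) (minElems_nonempty hS)

theorem mem_minElems_erase {S : Finset X} {x y : X} :
    y ∈ minElems (S.erase x) ↔ y ≠ x ∧ y ∈ S ∧ ∀ u ∈ S, u < y → u = x := by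
  simp only [mem_minElems, mem_erase]
  grind

theorem mem_minElems_erase_erase {S : Finset X} {x y z : X} :
    z ∈ minElems ((S.erase x).erase y) ↔
      z ≠ x ∧ z ≠ y ∧ z ∈ S ∧ ∀ u ∈ S, u < z → u = x ∨ u = y := by
  simp only [mem_minElems, mem_erase]
  grind

/-- A function on the minimal elements of `S`, transported to the minimal elements of
`S.erase x`: the elements that become minimal inherit the value at `x`. -/
noncomputable def transfer (S : Finset X) (x : X) (v : X → ℝ) (y : X) : ℝ :=
  if y ∈ minElems S then v y else v x

/-- The `x`-entry of the image of `v` under the matrix of initial pairs of linear extensions. -/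
noncomputable def extRow (S : Finset X) (v : X → ℝ) (x : X) : ℝ :=
  ∑ y ∈ minElems (S.erase x), extCount ((S.erase x).erase y) * transfer S x v y

/-- The bilinear form of initial pairs of linear extensions. -/
noncomputable def extForm (S : Finset X) (u v : X → ℝ) : ℝ :=
  ∑ x ∈ minElems S, u x * extRow S v x

/-- The matrix of initial pairs of linear extensions. -/
noncomputable def extMatrix (S : Finset X) (x y : X) : ℝ :=
  if x = y then ∑ z ∈ minElems (S.erase x) \ minElems S, (extCount ((S.erase x).erase z) : ℝ)
  else extCount ((S.erase x).erase y)

theorem extMatrix_comm (S : Finset X) (x y : X) : extMatrix S x y = extMatrix S y x := by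
  unfold extMatrix
  by_cases h : x = y
  · subst h; rfl
  · rw [if_neg h, if_neg (Ne.symm h), erase_right_comm]

theorem extMatrix_nonneg (S : Finset X) (x y : X) : 0 ≤ extMatrix S x y := by
  unfold extMatrix
  split_ifs
  · exact sum_nonneg fun _ _ => Nat.cast_nonneg _
  · exact Nat.cast_nonneg _

/-- The minimal elements of `S.erase x` are the other minimal elements of `S` and those freed by
`x`. The latter carry the value `v x`, so they contribute to the diagonal; this makes the form
visibly symmetric. -/
theorem extRow_eq_sum {S : Finset X} {x : X} (hx : x ∈ minElems S) (v : X → ℝ) :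
    extRow S v x = ∑ y ∈ minElems S, extMatrix S x y * v y := by
  have h1 : minElems (S.erase x) ∩ minElems S = (minElems S).erase x := by
    ext y
    simp only [mem_inter, mem_minElems_erase, mem_erase]
    rw [mem_minElems]; grind
  rw [extRow, ← sum_inter_add_sum_sdiff _ (minElems S), ← add_sum_erase _ _ hx, add_comm, h1]
  congr 1
  · rw [extMatrix, if_pos rfl, sum_mul]
    refine sum_congr rfl fun y hy => ?_
    rw [transfer, if_neg (mem_sdiff.1 hy).2]
  · refine sum_congr rfl fun y hy => ?_
    rw [mem_erase] at hy
    rw [transfer, if_pos hy.2, extMatrix, if_neg (Ne.symm hy.1)]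

theorem extForm_eq_sum (S : Finset X) (u v : X → ℝ) :
    extForm S u v = ∑ x ∈ minElems S, ∑ y ∈ minElems S, u x * extMatrix S x y * v y := by
  refine sum_congr rfl fun x hx => ?_
  rw [extRow_eq_sum hx, mul_sum]
  exact sum_congr rfl fun y _ => by ring

theorem extForm_comm (S : Finset X) (u v : X → ℝ) : extForm S u v = extForm S v u := by
  rw [extForm_eq_sum, extForm_eq_sum, sum_comm]
  exact sum_congr rfl fun x _ => sum_congr rfl fun y _ => by rw [extMatrix_comm]; ring

theorem transfer_one (S : Finset X) (x : X) : transfer S x 1 = 1 := by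
  ext y; simp [transfer]

theorem extRow_one {S : Finset X} {x : X} (hx : (S.erase x).Nonempty) :
    extRow S 1 x = extCount (S.erase x) := by
  rw [extRow, extCount_eq_sum hx, transfer_one]; simp

theorem extForm_one {S : Finset X} (hS : 2 ≤ S.card) : extForm S 1 1 = extCount S := by
  have h : ∀ x, (S.erase x).Nonempty := fun x =>
    card_pos.1 (by have := pred_card_le_card_erase (s := S) (a := x); omega)
  rw [extForm, extCount_eq_sum (card_pos.1 (by omega))]
  simp [extRow_one (h _)]

/-- The link between two levels: row sums for `S.erase x` are the counts that weight row `x` for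
`S`. It turns the induction hypothesis into a bound by the square of a row. -/
theorem extForm_transfer_one {S : Finset X} (hS : 3 ≤ S.card) (v : X → ℝ) (x : X) :
    extForm (S.erase x) (transfer S x v) 1 = extRow S v x := by
  have h : ∀ y, ((S.erase x).erase y).Nonempty := fun y =>
    card_pos.1 (by
      have := pred_card_le_card_erase (s := S) (a := x)
      have := pred_card_le_card_erase (s := S.erase x) (a := y)
      omega)
  rw [extForm, extRow]
  exact sum_congr rfl fun y _ => by rw [extRow_one (h y), mul_comm]

/-- Base of the induction. A chain gives equality; an antichain gives `4 * v a * v b ≤ (v a + v b) ^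
2`. -/
theorem extForm_pair_mul_le_sq {a b : X} (hab : a ≠ b) (v : X → ℝ) :
    extForm {a, b} v v * extForm {a, b} 1 1 ≤ extForm {a, b} 1 v ^ 2 := by
  wlog h : ¬ b < a generalizing a b
  · rw [pair_comm]
    exact this hab.symm fun h' => h fun h'' => h'.asymm h''
  have hs : ∀ x : X, minElems {x} = {x} := fun x => by
    ext y; simp only [mem_minElems, mem_singleton]; grind
  have ha : ({a, b} : Finset X).erase a = {b} := by grind
  have hb : ({a, b} : Finset X).erase b = {a} := by grind
  by_cases h' : a < b
  · have hm : minElems {a, b} = {a} := by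
      ext y; simp only [mem_minElems, mem_insert, mem_singleton]; grind
    simp [extForm, extRow, transfer, hm, ha, hs, extCount_empty, hab.symm]
    nlinarith
  · have hm : minElems {a, b} = {a, b} := by
      ext y; simp only [mem_minElems, mem_insert, mem_singleton]; grind
    simp [extForm, extRow, transfer, hm, ha, hb, hs, extCount_empty, hab]
    nlinarith [sq_nonneg (v a - v b)]

/-! ### Hyperbolicity by induction on the poset. -/

variable [Fintype X]

theorem sum_minElems_eq (S : Finset X) (f : X → ℝ) :
    ∑ x ∈ minElems S, f x = ∑ x, if x ∈ minElems S then f x else 0 := by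
  simp

/-- Both sides become sums over initial triples `x, y, z`, weighted by the count `E`, which is
symmetric. The difference splits into three kinds: `g₁` (all three minimal) cancels under exchanging
`x` and `z`; `g₃` (`x`, `y` minimal, `z` freed by `y` alone) cancels under a cyclic shift; `g₂` (`z`
freed only by `x` and `y` together) symmetrises to `E * (v x - v y) ^ 2`. -/
theorem extForm_le_sum_transfer {S : Finset X} (hS : 3 ≤ S.card) (v : X → ℝ) :
    extForm S v v ≤
      ∑ x ∈ minElems S, extForm (S.erase x) (transfer S x v) (transfer S x v) := by
  have hne : ∀ x y, ((S.erase x).erase y).Nonempty := fun x y =>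
    card_pos.1 (by
      have := pred_card_le_card_erase (s := S) (a := x)
      have := pred_card_le_card_erase (s := S.erase x) (a := y)
      omega)
  set E : X → X → X → ℝ := fun x y z => extCount (((S.erase x).erase y).erase z) with hE
  have hE1 : ∀ x y z, E x y z = E y x z := fun x y z => by
    simp only [hE]; rw [erase_right_comm (a := x)]
  have hE2 : ∀ x y z, E x y z = E x z y := fun x y z => by
    simp only [hE]; rw [erase_right_comm (a := y)]
  have hE0 : ∀ x y z, 0 ≤ E x y z := fun x y z => Nat.cast_nonneg _
  -- One more step of the recursion for `extCount` refines pairs to triples.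
  have hR : extForm S v v = ∑ x ∈ minElems S, ∑ y ∈ minElems (S.erase x),
      ∑ z ∈ minElems ((S.erase x).erase y), E x y z * (v x * transfer S x v y) := by
    refine sum_congr rfl fun x _ => ?_
    rw [extRow, mul_sum]
    refine sum_congr rfl fun y _ => ?_
    rw [extCount_eq_sum (hne x y), ← sum_mul]
    push_cast
    ring
  have hL : ∑ x ∈ minElems S, extForm (S.erase x) (transfer S x v) (transfer S x v) =
      ∑ x ∈ minElems S, ∑ y ∈ minElems (S.erase x),
      ∑ z ∈ minElems ((S.erase x).erase y), E x y z * (transfer S x v y *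
        if z ∈ minElems (S.erase x) then transfer S x v z else transfer S x v y) := by
    refine sum_congr rfl fun x _ => sum_congr rfl fun y _ => ?_
    rw [extRow, mul_sum]
    exact sum_congr rfl fun z _ => by rw [transfer.eq_1 (S.erase x)]; ring
  set p : X → Prop := fun x => x ∈ minElems S with hp
  set q : X → X → Prop := fun x y => y ∈ minElems (S.erase x) with hq
  set r : X → X → X → Prop := fun x y z => z ∈ minElems ((S.erase x).erase y) with hr
  classical
  set g₁ : X → X → X → ℝ := fun x y z =>
    if p x ∧ p y ∧ p z ∧ x ≠ y ∧ y ≠ z ∧ x ≠ z then E x y z * (v y * v z) else 0 with hg₁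
  set g₂ : X → X → X → ℝ := fun x y z =>
    if p x ∧ p y ∧ x ≠ y ∧ r x y z ∧ ¬ q x z ∧ ¬ q y z then E x y z * (v y ^ 2 - v x * v y) else 0
    with hg₂
  set g₃ : X → X → X → ℝ := fun x y z =>
    if p x ∧ p y ∧ x ≠ y ∧ q y z ∧ ¬ p z then E x y z * (v y ^ 2 - v x * v y) else 0 with hg₃
  have hpt : ∀ x y z, (if p x then if q x y then if r x y z then
      E x y z * (transfer S x v y * if z ∈ minElems (S.erase x) then transfer S x v z
        else transfer S x v y) - E x y z * (v x * transfer S x v y) else 0 else 0 else 0) =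
      (g₁ x y z - g₁ z y x) + g₂ x y z + (g₃ x y z - g₃ z x y) := by
    intro x y z
    -- The order enters only through `f₁`–`f₅`; what remains is a propositional case analysis.
    have f₁ : ∀ x y, p y → x ≠ y → q x y := by
      intro x y; simp only [hp, hq, mem_minElems]; grind
    have f₂ : ∀ x y, q x y → x ≠ y := by
      intro x y; simp only [hq, mem_minElems_erase]; grind
    have f₃ : ∀ x y z, r x y z → x ≠ z ∧ y ≠ z := by
      intro x y z; simp only [hr, mem_minElems_erase_erase]; grind
    have f₄ : ∀ x y z, q x z → y ≠ z → r x y z ∧ r y x z := by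
      intro x y z; simp only [hq, hr, mem_minElems_erase]; grind
    have f₅ : ∀ x y z, x ≠ y → q x z → q y z → p z := by
      intro x y z; simp only [hq, hp, mem_minElems]; grind
    have hT : ∀ w, transfer S x v w = if p w then v w else v x := fun w => rfl
    have hQ : (z ∈ minElems (S.erase x)) = q x z := rfl
    have e₁ : E z y x = E x y z := by rw [hE1, hE2, hE1]
    have e₂ : E z x y = E x y z := by rw [hE1, hE2]
    simp only [hg₁, hg₂, hg₃, hT, hQ, e₁, e₂]
    have a₁ := f₁ x y
    have a₂ := f₁ x z
    have a₃ := f₁ y z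
    have b₁ := f₂ x y
    have b₂ := f₂ x z
    have b₃ := f₂ y z
    have c := f₃ x y z
    have d₁ := f₄ x y z
    have d₂ := f₄ y x z
    have e := f₅ x y z
    clear f₁ f₂ f₃ f₄ f₅ hT hQ e₁ e₂ hR hL hp hq hr hg₁ hg₂ hg₃ hE hE1 hE2 hE0 hne
    by_cases px : p x
    · by_cases qxy : q x y
      · have hxy := b₁ qxy
        by_cases py : p y
        · by_cases rxyz : r x y z
          · obtain ⟨hxz, hyz⟩ := c rxyz
            by_cases pz : p z
            · have qxz := a₂ pz hxz
              have qyz := a₃ pz hyz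
              simp [*, Ne.symm hxz, Ne.symm hyz, Ne.symm hxy]
              exact Or.inl (mul_comm _ _)
            · by_cases qxz : q x z
              · have : ¬ q y z := fun h => pz (e hxy qxz h)
                simp [*]
                ring
              · by_cases qyz : q y z <;> simp [*]
                all_goals ring
          · have : ¬ (p z ∧ y ≠ z ∧ x ≠ z) := fun h => rxyz (d₁ (a₂ h.1 h.2.2) h.2.1).1
            have : ¬ q y z ∨ x = z := by
              by_contra! h
              exact rxyz (d₂ h.1 h.2).2
            grind
        · by_cases rxyz : r x y z
          · obtain ⟨hxz, hyz⟩ := c rxyz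
            by_cases pz : p z
            · have qxz := a₂ pz hxz
              simp [*, Ne.symm hxz]
              ring
            · by_cases qxz : q x z <;> simp [*]
          · have : ¬ (p z ∧ x ≠ z) := fun h =>
              rxyz (d₁ (a₂ h.1 h.2) (fun h' => py (h' ▸ h.1))).1
            grind
      · grind
    · simp [px]
  have hG : ∀ f : X → X → X → ℝ, (∑ x ∈ minElems S, ∑ y ∈ minElems (S.erase x),
      ∑ z ∈ minElems ((S.erase x).erase y), f x y z) =
      ∑ x, ∑ y, ∑ z, if p x then if q x y then if r x y z then f x y z else 0 else 0 else 0 := by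
    intro f
    simp only [hp, hq, hr]
    rw [sum_minElems_eq]
    refine sum_congr rfl fun x _ => ?_
    split_ifs
    · rw [sum_minElems_eq]
      refine sum_congr rfl fun y _ => ?_
      split_ifs
      · rw [sum_minElems_eq]
      · simp
    · simp
  rw [← sub_nonneg, hL, hR]
  simp only [← sum_sub_distrib]
  rw [hG]
  simp only [hpt, sum_add_distrib, sum_sub_distrib]
  have s₁ : ∑ x, ∑ y, ∑ z, g₁ z y x = ∑ x, ∑ y, ∑ z, g₁ x y z := by
    calc _ = ∑ x, ∑ z, ∑ y, g₁ z y x := sum_congr rfl fun x _ => sum_comm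
      _ = ∑ z, ∑ x, ∑ y, g₁ z y x := sum_comm
      _ = _ := sum_congr rfl fun x _ => sum_comm
  have s₃ : ∑ x, ∑ y, ∑ z, g₃ z x y = ∑ x, ∑ y, ∑ z, g₃ x y z := by
    calc _ = ∑ x, ∑ z, ∑ y, g₃ z x y := sum_congr rfl fun x _ => sum_comm
      _ = _ := sum_comm
  have s₂ : 0 ≤ ∑ x, ∑ y, ∑ z, (g₂ x y z + g₂ y x z) := by
    refine sum_nonneg fun x _ => sum_nonneg fun y _ => sum_nonneg fun z _ => ?_
    have h1 : r x y z ↔ r y x z := by simp only [hr]; rw [erase_right_comm]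
    have h2 : (p x ∧ p y ∧ x ≠ y ∧ r x y z ∧ ¬ q x z ∧ ¬ q y z) ↔
        (p y ∧ p x ∧ y ≠ x ∧ r y x z ∧ ¬ q y z ∧ ¬ q x z) := by
      rw [h1]; tauto
    simp only [hg₂]
    rw [hE1 y x]
    by_cases h : p x ∧ p y ∧ x ≠ y ∧ r x y z ∧ ¬ q x z ∧ ¬ q y z
    · rw [if_pos h, if_pos (h2.1 h), ← mul_add]
      exact mul_nonneg (hE0 _ _ _) (by nlinarith [sq_nonneg (v x - v y)])
    · rw [if_neg h, if_neg (fun h' => h (h2.2 h')), add_zero]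
  simp only [sum_add_distrib] at s₂
  rw [sum_comm (f := fun x y => ∑ z, g₂ y x z)] at s₂
  linarith

/-- The form of initial pairs of linear extensions is hyperbolic. -/
theorem extForm_self_mul_le_sq (S : Finset X) (hS : 2 ≤ S.card) (v : X → ℝ) :
    extForm S v v * extForm S 1 1 ≤ extForm S 1 v ^ 2 := by
  induction S using Finset.strongInduction generalizing v with
  | H S ih =>
  rcases hS.eq_or_lt with hS | hS
  · obtain ⟨a, b, hab, rfl⟩ := card_eq_two.1 hS.symm
    exact extForm_pair_mul_le_sq hab v
  have hcard : ∀ x, 2 ≤ (S.erase x).card := fun x => by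
    have := pred_card_le_card_erase (s := S) (a := x); omega
  have hne : ∀ x, (S.erase x).Nonempty := fun x => card_pos.1 (by have := hcard x; omega)
  -- pass to the matrix on the minimal elements
  set N : Matrix (minElems S) (minElems S) ℝ := fun i j => extMatrix S i j with hN
  set d : minElems S → ℝ := fun i => extCount (S.erase i) with hd
  have hrow : ∀ (w : X → ℝ) (i : minElems S), ∑ j, N i j * w j = extRow S w i := fun w i => by
    rw [extRow_eq_sum i.2]
    exact sum_coe_sort (minElems S) fun j => extMatrix S i j * w j
  have hform : ∀ u w : X → ℝ, ∑ i : minElems S, u i * extRow S w i = extForm S u w := fun u w =>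
    sum_coe_sort (minElems S) fun x => u x * extRow S w x
  have hd1 : ∀ i : minElems S, d i = extRow S 1 i := fun i => (extRow_one (hne i)).symm
  have hd0 : ∀ i : minElems S, 0 < d i := fun i => Nat.cast_pos.2 (extCount_pos _)
  have hext : ∀ w : minElems S → ℝ, ∃ w' : X → ℝ, w = fun i : minElems S => w' i := fun w =>
    ⟨fun x => if h : x ∈ minElems S then w ⟨x, h⟩ else 0, by ext i; simp⟩
  have hneg := sum_mul_mulVec_nonpos_of_le_sum_sq_div N (fun i j => extMatrix_comm S i j)
    (fun i j hij => by
      simp only [hN, extMatrix]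
      rw [if_neg fun h => hij (Subtype.ext h)]
      exact Nat.cast_pos.2 (extCount_pos _)) d
    (fun i => by rw [hd1, ← hrow]; simp) hd0
    -- The hypothesis `⟪v, T v⟫ ≤ ‖T v‖²`: the comparison with the forms of `S.erase x`, then the
    -- induction hypothesis for each term.
    (fun w => by
      obtain ⟨w, rfl⟩ := hext w
      simp only [hrow, hform]
      refine (extForm_le_sum_transfer hS w).trans ?_
      rw [← sum_coe_sort]
      refine sum_le_sum fun i _ => ?_
      rw [le_div_iff₀ (hd0 i)]
      have := ih _ (erase_ssubset (minElems_subset S i.2)) (hcard i) (transfer S i w)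
      rwa [extForm_one (hcard i), extForm_comm (S.erase ↑i) 1, extForm_transfer_one hS] at this)
  have h1 : 0 < extForm S 1 1 := by
    rw [extForm_one (by omega)]; exact Nat.cast_pos.2 (extCount_pos _)
  set a := extForm S 1 1 with ha
  set b := extForm S 1 v with hb
  -- The multiple by `a` of the projection of `v` orthogonal to `1`; then `extForm S w w = a * (a *
  -- extForm S v v - b ^ 2)`, and `a > 0`.
  set w : X → ℝ := fun x => a * v x - b with hw
  have hlin : ∀ u : X → ℝ, extForm S u w = a * extForm S u v - b * extForm S u 1 := by
    intro u
    simp only [extForm_eq_sum, mul_sum, ← sum_sub_distrib, hw, Pi.one_apply]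
    exact sum_congr rfl fun x _ => sum_congr rfl fun y _ => by ring
  have := hneg (fun i => w i) (by
    have : extForm S w 1 = 0 := by
      rw [extForm_comm, hlin, ← ha, ← hb]; ring
    rw [← this, ← hform]
    exact sum_congr rfl fun i _ => by rw [hd1, mul_comm])
  simp only [hrow, hform] at this
  rw [hlin, extForm_comm S w v, extForm_comm S w 1, hlin, hlin, ← ha, ← hb, extForm_comm S v 1,
    ← hb] at this
  nlinarith

end Extensions

/-! ### The recursive count agrees with the number of order-preserving labelings. -/

section Labelings

variable {X : Type*} [PartialOrder X]

/-- The linear extensions of the subposet `S`, with labels `k + 1, …, k + #S`, extended by zero. -/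
def labelings (S : Finset X) (k : ℕ) : Set (X → ℕ) :=
  {g | Set.BijOn g S (Set.Icc (k + 1) (k + S.card)) ∧ (∀ x ∈ S, ∀ y ∈ S, x < y → g x < g y) ∧
    ∀ x ∉ S, g x = 0}

theorem labelings_finite [Finite X] (S : Finset X) (k : ℕ) : (labelings S k).Finite := by
  refine (Set.Finite.pi' fun _ : X => Set.finite_Iic (k + S.card)).subset fun g hg x => ?_
  by_cases hx : x ∈ S
  · exact (hg.1.mapsTo hx).2
  · rw [hg.2.2 x hx]; exact Nat.zero_le _

theorem labelings_empty (k : ℕ) : labelings (∅ : Finset X) k = {0} := by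
  ext g
  simp [labelings, funext_iff, Set.bijOn_empty_iff_left]

theorem mem_minElems_of_mem_labelings {S : Finset X} {k : ℕ} {g : X → ℕ} (hg : g ∈ labelings S k)
    {x : X} (hx : g x = k + 1) : x ∈ minElems S := by
  have hxS : x ∈ S := by
    by_contra h
    have := hg.2.2 x h
    omega
  refine mem_minElems.2 ⟨hxS, fun y hy hlt => ?_⟩
  have h1 := hg.2.1 y hy x hxS hlt
  have h2 := (hg.1.mapsTo hy).1
  omega

variable [DecidableEq X]

/-- The offset `k` lets the remaining elements keep their labels when the first one is removed, so
the bijection changes a single value. -/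
theorem bijOn_update_labelings {S : Finset X} {x : X} (hx : x ∈ minElems S) (k : ℕ) :
    Set.BijOn (fun h : X → ℕ => Function.update h x (k + 1)) (labelings (S.erase x) (k + 1))
      {g ∈ labelings S k | g x = k + 1} := by
  obtain ⟨hxS, hmin⟩ := mem_minElems.1 hx
  have hcard := card_erase_add_one hxS
  refine ⟨fun h hh => ⟨⟨⟨?_, ?_, ?_⟩, ?_, ?_⟩, by simp⟩, ?_, ?_⟩
  · intro y hy
    rcases eq_or_ne y x with rfl | hyx
    · simp only [Function.update_self, Set.mem_Icc]; omega
    · have := hh.1.mapsTo (mem_erase.2 ⟨hyx, hy⟩)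
      simp only [Function.update_of_ne hyx, Set.mem_Icc] at this ⊢; omega
  · intro y hy z hz hyz
    by_contra hne
    have key : ∀ w ∈ S, w ≠ x → k + 1 < h w := fun w hw hwx => by
      have := (hh.1.mapsTo (mem_erase.2 ⟨hwx, hw⟩)).1
      omega
    rcases eq_or_ne y x with rfl | hyx
    · have := key z hz (Ne.symm hne)
      simp [Function.update_of_ne (Ne.symm hne)] at hyz; omega
    rcases eq_or_ne z x with rfl | hzx
    · have := key y hy hne
      simp [Function.update_of_ne hne] at hyz; omega
    simp only [Function.update_of_ne hyx, Function.update_of_ne hzx] at hyz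
    exact hne (hh.1.injOn (mem_erase.2 ⟨hyx, hy⟩) (mem_erase.2 ⟨hzx, hz⟩) hyz)
  · intro m hm
    rcases eq_or_ne m (k + 1) with rfl | hm'
    · exact ⟨x, hxS, by simp⟩
    · obtain ⟨y, hy, rfl⟩ := hh.1.surjOn (show m ∈ Set.Icc (k + 1 + 1) (k + 1 + (S.erase x).card) by
        simp only [Set.mem_Icc] at hm ⊢; omega)
      have := mem_erase.1 hy
      exact ⟨y, this.2, by simp [Function.update_of_ne this.1]⟩
  · intro y hy z hz hlt
    have hzx : z ≠ x := fun h' => hmin y hy (h' ▸ hlt)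
    have h1 := (hh.1.mapsTo (mem_erase.2 ⟨hzx, hz⟩)).1
    simp only [Function.update_of_ne hzx]
    rcases eq_or_ne y x with rfl | hyx
    · simp only [Function.update_self]; omega
    · simp only [Function.update_of_ne hyx]
      exact hh.2.1 y (mem_erase.2 ⟨hyx, hy⟩) z (mem_erase.2 ⟨hzx, hz⟩) hlt
  · intro y hy
    have hyx : y ≠ x := fun h' => hy (h' ▸ hxS)
    simp only [Function.update_of_ne hyx]
    exact hh.2.2 y fun h' => hy (mem_of_mem_erase h')
  · intro g hg h hh hgh
    ext y
    rcases eq_or_ne y x with rfl | hyx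
    · rw [hg.2.2 y (by simp), hh.2.2 y (by simp)]
    · have := congrFun hgh y
      simpa [Function.update_of_ne hyx] using this
  · rintro g ⟨hg, hgx⟩
    have hne : ∀ y ∈ S.erase x, y ≠ x ∧ y ∈ S := fun y hy => mem_erase.1 hy
    -- The inverse resets `x` to the default `0` required outside `S.erase x`; genuine labels are at
    -- least `k + 1`.
    refine ⟨Function.update g x 0, ⟨⟨?_, ?_, ?_⟩, ?_, ?_⟩, ?_⟩
    · intro y hy
      obtain ⟨hyx, hyS⟩ := hne y hy
      have h1 := hg.1.mapsTo hyS
      have h2 : g y ≠ k + 1 := fun h' => hyx (hg.1.injOn hyS hxS (h'.trans hgx.symm))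
      simp only [Function.update_of_ne hyx, Set.mem_Icc] at h1 ⊢; omega
    · intro y hy z hz hyz
      obtain ⟨hyx, hyS⟩ := hne y hy
      obtain ⟨hzx, hzS⟩ := hne z hz
      simp only [Function.update_of_ne hyx, Function.update_of_ne hzx] at hyz
      exact hg.1.injOn hyS hzS hyz
    · intro m hm
      obtain ⟨y, hy, rfl⟩ := hg.1.surjOn (show m ∈ Set.Icc (k + 1) (k + S.card) by
        simp only [Set.mem_Icc] at hm ⊢; omega)
      have hyx : y ≠ x := by
        rintro rfl
        simp only [Set.mem_Icc] at hm; omega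
      exact ⟨y, mem_erase.2 ⟨hyx, hy⟩, by simp [Function.update_of_ne hyx]⟩
    · intro y hy z hz hlt
      obtain ⟨hyx, hyS⟩ := hne y hy
      obtain ⟨hzx, hzS⟩ := hne z hz
      simp only [Function.update_of_ne hyx, Function.update_of_ne hzx]
      exact hg.2.1 y hyS z hzS hlt
    · intro y hy
      rcases eq_or_ne y x with rfl | hyx
      · simp
      · simp only [Function.update_of_ne hyx]
        exact hg.2.2 y fun h' => hy (mem_erase.2 ⟨hyx, h'⟩)
    · ext y
      rcases eq_or_ne y x with rfl | hyx
      · simp [hgx]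
      · simp [Function.update_of_ne hyx]

theorem ncard_labelings [Finite X] (S : Finset X) (k : ℕ) :
    (labelings S k).ncard = extCount S := by
  induction S using Finset.strongInduction generalizing k with
  | H S ih =>
  rcases S.eq_empty_or_nonempty with rfl | hS
  · rw [labelings_empty, Set.ncard_singleton, extCount_empty]
  have hU : labelings S k = ⋃ x ∈ minElems S, {g ∈ labelings S k | g x = k + 1} := by
    ext g
    simp only [Set.mem_iUnion, Set.mem_ofPred_eq, exists_prop]
    constructor
    · intro hg
      obtain ⟨x, hx, hgx⟩ := hg.1.surjOn (show k + 1 ∈ Set.Icc (k + 1) (k + S.card) from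
        ⟨le_rfl, by have := card_pos.2 hS; omega⟩)
      exact ⟨x, mem_minElems_of_mem_labelings hg hgx, hg, hgx⟩
    · rintro ⟨x, _, hg, _⟩
      exact hg
  rw [extCount_eq_sum hS, hU, ← Finset.set_biUnion_coe, (minElems S).finite_toSet.ncard_biUnion
    (fun x _ => (labelings_finite S k).subset fun g hg => hg.1), finsum_mem_coe_finset]
  · refine sum_congr rfl fun x hx => ?_
    have h := bijOn_update_labelings hx k
    rw [← h.image_eq, h.injOn.ncard_image, ih _ (erase_ssubset (minElems_subset S hx))]
  · intro x hx y hy hxy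
    refine Set.disjoint_left.2 fun g hg hg' => hxy ?_
    exact hg.1.1.injOn (minElems_subset S hx) (minElems_subset S hy) (hg.2.trans hg'.2.symm)

theorem ncard_labelings_pair [Finite X] {S : Finset X} {x y : X} (hx : x ∈ minElems S)
    (hy : y ∈ minElems (S.erase x)) (k : ℕ) :
    {g ∈ labelings S k | g x = k + 1 ∧ g y = k + 2}.ncard = extCount ((S.erase x).erase y) := by
  have h1 := bijOn_update_labelings hx k
  have h2 := bijOn_update_labelings hy (k + 1)
  have hyx : y ≠ x := (mem_minElems_erase.1 hy).1
  rw [← ncard_labelings _ (k + 1 + 1), ← h2.injOn.ncard_image, h2.image_eq,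
    ← (h1.injOn.mono fun h (hh : h ∈ {g ∈ labelings (S.erase x) (k + 1) | g y = k + 1 + 1}) =>
      hh.1).ncard_image]
  congr 1
  ext g
  constructor
  · rintro ⟨hg, hgx, hgy⟩
    obtain ⟨h, hh, rfl⟩ := h1.surjOn ⟨hg, hgx⟩
    exact ⟨h, ⟨hh, by simpa [Function.update_of_ne hyx] using hgy⟩, rfl⟩
  · rintro ⟨h, ⟨hh, hhy⟩, rfl⟩
    obtain ⟨h3, h4⟩ := h1.mapsTo hh
    exact ⟨h3, h4, by simpa [Function.update_of_ne hyx] using hhy⟩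

end Labelings

/-! ### Events for the first two elements as values of the form. -/

section Events

variable {X : Type*} [PartialOrder X] [Fintype X]

theorem mem_labelings_of_linExt (f : PosetLinExt X) :
    (fun x => (f.1 x : ℕ)) ∈ labelings (univ : Finset X) 0 := by
  refine ⟨⟨fun x _ => ?_, fun x _ y _ h => f.1.injective (Subtype.ext h), fun m hm => ?_⟩,
    fun x _ y _ h => f.2 x y h, fun x hx => absurd (mem_univ x) hx⟩
  · have := mem_Icc.1 (f.1 x).2
    simpa using this
  · have hm' : m ∈ Icc 1 (Fintype.card X) := by simpa using hm
    exact ⟨f.1.symm ⟨m, hm'⟩, by simp, by simp⟩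

theorem ncard_linExt_pair [DecidableEq X] {x y : X} (hx : x ∈ minElems univ)
    (hy : y ∈ minElems (univ.erase x)) :
    {f : PosetLinExt X | (f.1 x : ℕ) = 1 ∧ (f.1 y : ℕ) = 2}.ncard =
      extCount ((univ.erase x).erase y) := by
  rw [← ncard_labelings_pair hx hy 0]
  have hinj : Function.Injective fun (f : PosetLinExt X) (x : X) => (f.1 x : ℕ) :=
    fun f g h => Subtype.ext (Equiv.ext fun x => Subtype.ext (congrFun h x))
  rw [← Set.ncard_image_of_injective _ hinj]
  congr 1
  ext g
  constructor
  · rintro ⟨f, ⟨h1, h2⟩, rfl⟩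
    exact ⟨mem_labelings_of_linExt f, h1, h2⟩
  · rintro ⟨hg, h1, h2⟩
    have hmem : ∀ x, g x ∈ Icc 1 (Fintype.card X) := fun x => by
      simpa using hg.1.mapsTo (mem_coe.2 (mem_univ x))
    let φ : X → Icc 1 (Fintype.card X) := fun x => ⟨g x, hmem x⟩
    have hφ : Function.Bijective φ := by
      refine ⟨fun x y h => hg.1.injOn (by simp) (by simp) (congrArg Subtype.val h), fun m => ?_⟩
      obtain ⟨x, _, hx⟩ := hg.1.surjOn (show (m : ℕ) ∈ Set.Icc (0 + 1) (0 + (univ : Finset X).card)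
        by simpa [-Subtype.coe_prop] using mem_Icc.1 m.2)
      exact ⟨x, Subtype.ext hx⟩
    exact ⟨⟨Equiv.ofBijective φ hφ, fun x y h => hg.2.1 x (mem_univ x) y (mem_univ y) h⟩,
      ⟨h1, h2⟩, rfl⟩

theorem mem_minElems_univ_of_linExt (f : PosetLinExt X) {x : X} (hx : (f.1 x : ℕ) = 1) :
    x ∈ minElems univ := by
  refine mem_minElems.2 ⟨mem_univ x, fun y _ hlt => ?_⟩
  have h1 : (f.1 y : ℕ) < f.1 x := f.2 y x hlt
  have h2 := (mem_Icc.1 (f.1 y).2).1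
  omega

theorem mem_minElems_erase_of_linExt [DecidableEq X] (f : PosetLinExt X) {x y : X}
    (hx : (f.1 x : ℕ) = 1) (hy : (f.1 y : ℕ) = 2) : y ∈ minElems (univ.erase x) := by
  refine mem_minElems_erase.2 ⟨?_, mem_univ y, fun u _ hlt => ?_⟩
  · rintro rfl
    omega
  · have h1 : (f.1 u : ℕ) < f.1 y := f.2 u y hlt
    have h2 := (mem_Icc.1 (f.1 u).2).1
    exact f.1.injective (Subtype.ext (by omega))

open Classical in
theorem ncard_event (S T : Set X) :
    ({f : PosetLinExt X | 1 ∈ f.image S ∧ 2 ∈ f.image T}.ncard : ℝ) =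
      ∑ x ∈ minElems univ, ∑ y ∈ minElems (univ.erase x),
        if x ∈ S ∧ y ∈ T then (extCount ((univ.erase x).erase y) : ℝ) else 0 := by
  -- The event is the disjoint union over the possible pairs of first and second elements.
  set P : Finset (Σ _ : X, X) := ((minElems univ).sigma fun x => minElems (univ.erase x)).filter
    fun p => p.1 ∈ S ∧ p.2 ∈ T with hP
  have hmem : ∀ p, p ∈ P ↔ (p.1 ∈ minElems univ ∧ p.2 ∈ minElems (univ.erase p.1)) ∧
      p.1 ∈ S ∧ p.2 ∈ T := fun p => by simp only [hP, mem_filter, mem_sigma]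
  have hU : {f : PosetLinExt X | 1 ∈ f.image S ∧ 2 ∈ f.image T} =
      ⋃ p ∈ (P : Set (Σ _ : X, X)), {f | (f.1 p.1 : ℕ) = 1 ∧ (f.1 p.2 : ℕ) = 2} := by
    ext f
    simp only [Set.mem_iUnion, Set.mem_ofPred_eq, exists_prop, mem_coe, hmem]
    constructor
    · rintro ⟨⟨x, hxS, hx⟩, y, hyT, hy⟩
      exact ⟨⟨x, y⟩, ⟨⟨mem_minElems_univ_of_linExt f hx, mem_minElems_erase_of_linExt f hx hy⟩,
        hxS, hyT⟩, hx, hy⟩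
    · rintro ⟨p, ⟨_, hS, hT⟩, h1, h2⟩
      exact ⟨⟨p.1, hS, h1⟩, p.2, hT, h2⟩
  rw [hU, P.finite_toSet.ncard_biUnion (fun p _ => Set.toFinite _), finsum_mem_coe_finset,
    sum_congr rfl fun p hp => ncard_linExt_pair ((hmem p).1 hp).1.1 ((hmem p).1 hp).1.2, hP,
    sum_filter, sum_sigma]
  · push_cast
    rfl
  · rintro ⟨x, y⟩ _ ⟨x', y'⟩ _ hne
    refine Set.disjoint_left.2 fun f hf hf' => hne ?_
    have h1 : x = x' := f.1.injective (Subtype.ext (hf.1.trans hf'.1.symm))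
    have h2 : y = y' := f.1.injective (Subtype.ext (hf.2.trans hf'.2.symm))
    rw [h1, h2]

open Classical in
/-- The number of linear extensions starting with `x ∈ S` and `y ∈ T`, as a value of `extForm`: it
suffices that `T` agrees with `U` on the minimal elements, and that `T` contains an element `y` that
becomes minimal on removal of `x ∈ S` exactly when `x ∈ U`. -/
theorem ncard_event_eq_extForm (S T U : Set X)
    (hST : ∀ x ∈ S, ∀ y ∈ minElems (univ : Finset X), y ∈ T ↔ y ∈ U)
    (hST' : ∀ x ∈ S, ∀ y ∉ minElems (univ : Finset X), y ∈ minElems (univ.erase x) →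
      (y ∈ T ↔ x ∈ U)) :
    ({f : PosetLinExt X | 1 ∈ f.image S ∧ 2 ∈ f.image T}.ncard : ℝ) =
      extForm univ (S.indicator 1) (U.indicator 1) := by
  rw [ncard_event]
  refine sum_congr rfl fun x hx => ?_
  rw [extRow, mul_sum]
  refine sum_congr rfl fun y hy => ?_
  by_cases hxS : x ∈ S
  · simp only [hxS, true_and, Set.indicator_of_mem, Pi.one_apply, one_mul, transfer]
    by_cases hym : y ∈ minElems (univ : Finset X)
    · simp [hym, hST x hxS y hym, Set.indicator_apply]
    · simp [hym, hST' x hxS y hym hy, Set.indicator_apply]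
  · simp [hxS]

end Events

/-! ### From hyperbolicity to probabilities. -/

section Main

variable {X : Type*} [PartialOrder X] [Fintype X]

open Classical in
/-- `extForm univ` as a bilinear map. -/
noncomputable def extBilin (X : Type*) [PartialOrder X] [Fintype X] :
    (X → ℝ) →ₗ[ℝ] (X → ℝ) →ₗ[ℝ] ℝ :=
  LinearMap.mk₂ ℝ (extForm univ)
    (fun u u' v => by simp [extForm, add_mul, sum_add_distrib])
    (fun c u v => by simp [extForm, mul_sum, mul_assoc])
    (fun u v v' => by
      rw [extForm_comm, extForm_comm _ u, extForm_comm _ u]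
      simp [extForm, add_mul, sum_add_distrib])
    (fun c u v => by
      rw [extForm_comm, extForm_comm _ u]
      simp [extForm, mul_sum, mul_assoc])

theorem extBilin_comm (u v : X → ℝ) : extBilin X u v = extBilin X v u := by
  classical exact extForm_comm _ u v

theorem extBilin_mul_le_sq (hX : 2 ≤ Fintype.card X) (v c : X → ℝ) (hc : 0 ≤ extBilin X c c) :
    extBilin X v v * extBilin X c c ≤ extBilin X c v ^ 2 := by
  classical
  refine (extBilin X).mul_le_sq_of_reversed extBilin_comm 1
    (fun v => extForm_self_mul_le_sq univ hX v) ?_ v c hc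
  have : extBilin X 1 1 = extCount (univ : Finset X) := extForm_one hX
  rw [this]
  exact Nat.cast_pos.2 (extCount_pos _)

theorem mem_minElems_univ_iff {x : X} : x ∈ minElems (univ : Finset X) ↔ IsMin x := by
  rw [mem_minElems, isMin_iff_forall_not_lt]; simp

theorem card_linExt_pos {x y : X} (hx : IsMin x) (hy : IsMin y) (hxy : x ≠ y) :
    0 < Nat.card (PosetLinExt X) := by
  classical
  have h := ncard_linExt_pair (mem_minElems_univ_iff.2 hx) (y := y)
    (mem_minElems_erase.2 ⟨hxy.symm, mem_univ y, fun u _ hu => absurd hu hy.not_lt⟩)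
  have := (Set.ncard_pos (Set.toFinite _)).1 (h ▸ extCount_pos _)
  have : Nonempty (PosetLinExt X) := ⟨this.some⟩
  exact Nat.card_pos

open Classical in
theorem extBilin_indicator (A B : Set X) :
    extBilin X (A.indicator 1) (B.indicator 1) = ∑ x ∈ minElems univ, ∑ y ∈ minElems univ,
      A.indicator 1 x * extMatrix univ x y * B.indicator 1 y :=
  extForm_eq_sum univ _ _

theorem indicator_mul_extMatrix_nonneg [DecidableEq X] (A B : Set X) (x y : X) :
    0 ≤ A.indicator 1 x * extMatrix univ x y * B.indicator 1 y :=
  mul_nonneg (mul_nonneg (Set.indicator_nonneg (fun _ _ => zero_le_one) x)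
    (extMatrix_nonneg _ x y)) (Set.indicator_nonneg (fun _ _ => zero_le_one) y)

theorem extBilin_indicator_nonneg (A B : Set X) :
    0 ≤ extBilin X (A.indicator 1) (B.indicator 1) := by
  classical
  rw [extBilin_indicator]
  exact sum_nonneg fun x _ => sum_nonneg fun y _ => indicator_mul_extMatrix_nonneg A B x y

theorem extBilin_indicator_pos {A B : Set X} (hA : A.Nonempty) (hB : B.Nonempty)
    (hAmin : ∀ x ∈ A, IsMin x) (hBmin : ∀ x ∈ B, IsMin x) (hAB : Disjoint A B) :
    0 < extBilin X (A.indicator 1) (B.indicator 1) := by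
  classical
  obtain ⟨a, ha⟩ := hA
  obtain ⟨b, hb⟩ := hB
  have hab : a ≠ b := fun h => Set.disjoint_left.1 hAB ha (h ▸ hb)
  rw [extBilin_indicator]
  refine sum_pos' (fun x _ => sum_nonneg fun y _ => indicator_mul_extMatrix_nonneg A B x y)
    ⟨a, mem_minElems_univ_iff.2 (hAmin a ha), sum_pos'
      (fun y _ => indicator_mul_extMatrix_nonneg A B a y)
      ⟨b, mem_minElems_univ_iff.2 (hBmin b hb), ?_⟩⟩
  simp [ha, hb, extMatrix, hab, extCount_pos]

/-- An element freed by `x ∈ A` is not minimal, hence not in `B`; correspondingly the diagonal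
contributes nothing, since `x ∉ B`. -/
theorem probOneTwo_eq_of_disjoint {A B : Set X} (hBmin : ∀ x ∈ B, IsMin x)
    (hAB : Disjoint A B) :
    PosetLinExt.probOneTwo A B =
      extBilin X (A.indicator 1) (B.indicator 1) / Nat.card (PosetLinExt X) := by
  classical
  rw [PosetLinExt.probOneTwo, PosetLinExt.prob, ncard_event_eq_extForm A B B]
  · rfl
  · exact fun _ _ _ _ => Iff.rfl
  · exact fun x hx y hy _ => iff_of_false (fun h => hy (mem_minElems_univ_iff.2 (hBmin y h)))
      (Set.disjoint_left.1 hAB hx)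

/-- After `x ∈ C`, a second element freed by `x` lies above `x`, so it is always in `C↑` and matches
the diagonal entry; one that was already minimal lies in `C↑` only if it lies in `C`. -/
theorem probOneTwo_upperClosure (C : Set X) :
    PosetLinExt.probOneTwo C (upperClosure C : Set X) =
      extBilin X (C.indicator 1) (C.indicator 1) / Nat.card (PosetLinExt X) := by
  classical
  rw [PosetLinExt.probOneTwo, PosetLinExt.prob, ncard_event_eq_extForm C _ C]
  · rfl
  · intro x _ y hy
    refine ⟨fun h => ?_, fun h => subset_upperClosure h⟩
    obtain ⟨c, hc, hcy⟩ := mem_upperClosure.1 h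
    rwa [(mem_minElems_univ_iff.1 hy).eq_of_le hcy] at hc
  · intro x hx y hy hy'
    refine iff_of_true (mem_upperClosure.2 ⟨x, hx, ?_⟩) hx
    rw [mem_minElems_univ_iff, isMin_iff_forall_not_lt] at hy
    push Not at hy
    obtain ⟨u, hu⟩ := hy
    have := (mem_minElems_erase.1 hy').2.2 u (mem_univ u) hu
    exact this ▸ hu.le

theorem div_mul_div_div_div_mul_div {n p q r s : ℝ} (hn : 0 < n) :
    (p / n * (q / n)) / (r / n * (s / n)) = (p * q) / (r * s) := by
  have := hn.ne'
  field_simp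

end Main

theorem theoremt {X : Type*} [PartialOrder X] [Fintype X] (A B C : Set X)
    (hA : A.Nonempty) (hB : B.Nonempty) (hC : C.Nonempty)
    (hAmin : ∀ x ∈ A, IsMin x) (hBmin : ∀ x ∈ B, IsMin x) (hCmin : ∀ x ∈ C, IsMin x)
    (hAB : Disjoint A B) (hAC : Disjoint A C) (hBC : Disjoint B C) :
    (0 < PosetLinExt.probOneTwo A C * PosetLinExt.probOneTwo B C ∧
      (PosetLinExt.probOneTwo C (upperClosure C : Set X) * PosetLinExt.probOneTwo A B) /
        (PosetLinExt.probOneTwo A C * PosetLinExt.probOneTwo B C) ≤ 2) ∧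
    ∃ (σ : Equiv.Perm (Fin 3)) (A' B' C' : Set X),
      A' = ![A, B, C] (σ 0) ∧ B' = ![A, B, C] (σ 1) ∧ C' = ![A, B, C] (σ 2) ∧
      0 < PosetLinExt.probOneTwo A' C' * PosetLinExt.probOneTwo B' C' ∧
      (PosetLinExt.probOneTwo C' (upperClosure C' : Set X) * PosetLinExt.probOneTwo A' B') /
        (PosetLinExt.probOneTwo A' C' * PosetLinExt.probOneTwo B' C') ≤ 1 := by
  obtain ⟨a, ha⟩ := id hA
  obtain ⟨b, hb⟩ := id hB
  have hab : a ≠ b := fun h => Set.disjoint_left.1 hAB ha (h ▸ hb)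
  have hX : 2 ≤ Fintype.card X := Fintype.one_lt_card_iff.2 ⟨a, b, hab⟩
  have hn : (0 : ℝ) < Nat.card (PosetLinExt X) :=
    Nat.cast_pos.2 (card_linExt_pos (hAmin a ha) (hBmin b hb) hab)
  rw [probOneTwo_upperClosure C, probOneTwo_eq_of_disjoint hBmin hAB,
    probOneTwo_eq_of_disjoint hCmin hAC, probOneTwo_eq_of_disjoint hCmin hBC,
    div_mul_div_div_div_mul_div hn]
  have pab := extBilin_indicator_pos hA hB hAmin hBmin hAB
  have pac := extBilin_indicator_pos hA hC hAmin hCmin hAC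
  have pbc := extBilin_indicator_pos hB hC hBmin hCmin hBC
  have paa := extBilin_indicator_nonneg A A
  have pbb := extBilin_indicator_nonneg B B
  have pcc := extBilin_indicator_nonneg C C
  refine ⟨⟨by positivity, ?_⟩, ?_⟩
  · rw [div_le_iff₀ (by positivity)]
    exact (extBilin X).mul_le_two_mul_of_reversed extBilin_comm _ _ _
      (fun v => extBilin_mul_le_sq hX v _ pcc) paa pbb pcc pac pbc
  · have hle := extBilin_mul_le_sq hX (A.indicator 1) (C.indicator 1) pcc
    rw [extBilin_comm (C.indicator 1) (A.indicator 1)] at hle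
    have hor : extBilin X (C.indicator 1) (C.indicator 1) * extBilin X (A.indicator 1) (B.indicator 1)
          ≤ extBilin X (A.indicator 1) (C.indicator 1) * extBilin X (B.indicator 1) (C.indicator 1) ∨
        extBilin X (A.indicator 1) (A.indicator 1) * extBilin X (B.indicator 1) (C.indicator 1)
          ≤ extBilin X (A.indicator 1) (C.indicator 1) *
            extBilin X (A.indicator 1) (B.indicator 1) := by
      -- If both failed, the product of the two inequalities, after cancelling `B 1_A 1_B * B 1_B
      -- 1_C`, would contradict `hle`.
      by_contra! h
      have := mul_lt_mul'' h.1 h.2 (by positivity) (by positivity)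
      have h3 := mul_le_mul_of_nonneg_right hle (mul_pos pab pbc).le
      nlinarith
    rcases hor with h | h
    · refine ⟨1, A, B, C, rfl, rfl, rfl, ?_⟩
      rw [probOneTwo_upperClosure C, probOneTwo_eq_of_disjoint hBmin hAB,
        probOneTwo_eq_of_disjoint hCmin hAC, probOneTwo_eq_of_disjoint hCmin hBC,
        div_mul_div_div_div_mul_div hn]
      exact ⟨by positivity, (div_le_one (by positivity)).2 h⟩
    -- Here `A` takes the special role of `C'`.
    · refine ⟨Equiv.swap 0 2, C, B, A, rfl, rfl, rfl, ?_⟩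
      rw [probOneTwo_upperClosure A, probOneTwo_eq_of_disjoint hBmin hBC.symm,
        probOneTwo_eq_of_disjoint hAmin hAC.symm,
        probOneTwo_eq_of_disjoint hAmin hAB.symm, div_mul_div_div_div_mul_div hn,
        extBilin_comm (C.indicator 1), extBilin_comm (C.indicator 1),
        extBilin_comm (B.indicator 1) (A.indicator 1)]
      exact ⟨by positivity, (div_le_one (by positivity)).2 h⟩
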